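/- Call a topological space a Cantor set if it is homeomorphic to the standard middle-thirds Cantor set. For a metric space $X$, let $\mathcal C(X)$ be the space of all Cantor sets $K\subset X$ with the Hausdorff metric. A typical Cantor set in $X$ is said to have a property if $\mathcal C(X)$ is a non-empty Baire space and the set of those $K\in\mathcal C(X)$ that have the property is comeager in $\mathcal C(X)$ (contains the intersection of countably many dense open subsets of $\mathcal C(X)$). (1) Let $N\ge 2$ be an integer. A typical Cantor set $K$ in $\mathbb R^N$ has the following property: for every non-zero linear subspace $V\subset\mathbb R^N$, the image of $K$ under the orthogonal projection $\mathbb R^N\to V$ is a Cantor set. (2) A typical Cantor set $K$ in the real Hilbert space $\ell_2$ has the following property: for every non-zero closed linear subspace $V\subset\ell_2$ such that the orthogonal projection $\ell_2\to V$ has finite-dimensional kernel, the image of $K$ under this projection is a Cantor set. -/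

import Mathlib

open TopologicalSpace Filter Topology

/-- A subset of a topological space is a Cantor set if, with the subspace topology, it is
homeomorphic to the standard middle-thirds Cantor set. -/
def IsCantorSet {X : Type*} [TopologicalSpace X] (s : Set X) : Prop :=
  Nonempty (s ≃ₜ cantorSet)

/-- The space of all Cantor sets in a metric space `X`, a subspace of the space of all
non-empty compact subsets of `X` with the Hausdorff metric. -/
abbrev CantorSets (X : Type*) [MetricSpace X] : Type _ :=
  {K : NonemptyCompacts X // IsCantorSet (K : Set X)}

/-- A typical element of `𝒳` satisfies `P`: the space `𝒳` is a non-empty Baire space, and the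
set of elements that satisfy `P` is comeager in `𝒳`. -/
def Typical (𝒳 : Type*) [TopologicalSpace 𝒳] (P : 𝒳 → Prop) : Prop :=
  Nonempty 𝒳 ∧ BaireSpace 𝒳 ∧ {x | P x} ∈ residual 𝒳

/-- The real Hilbert space of square-summable sequences. -/
abbrev RealEllTwo : Type := lp (fun _ : ℕ => ℝ) 2

/-! A typical Cantor set `K` is in general position: if the space contains `n` independent vectors,
then any `n` differences `p - q` over disjoint pairs of points of `K` are independent
(`typical_pairwiseGeneric`). A continuous linear map whose kernel has dimension less than `n`
therefore identifies only finitely many points of `K`, since otherwise `n` disjoint identified pairs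
would give `n` independent vectors in the kernel. Such a map keeps the compact image totally
disconnected and perfect, so by Brouwer's characterisation (`isCantorSet_iff`) the image is a Cantor
set.

Genericity comes from Baire category in the complete hyperspace of compact sets. At each scale, the
condition is open by compactness, and dense because finite sets are dense and can be moved into
general position. Cantor sets form a dense Gδ there, hence a Baire space that inherits the density
of these open sets. -/

/-! ### Brouwer's characterisation of the Cantor space -/

section Brouwer

variable {X : Type*} [TopologicalSpace X]

/-- A clopen set `A` splits into two clopen pieces, each nonempty unless `A` is, neither of which
is cut by the given clopen set `B`. -/
theorem exists_clopens_split [CompactSpace X] [T2Space X] [TotallyDisconnectedSpace X]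
    [PerfectSpace X] (A B : Clopens X) :
    ∃ H : Clopens X, H ≤ A ∧ (A ≠ ⊥ → H ≠ ⊥ ∧ A \ H ≠ ⊥) ∧
      ∀ x ∈ A, ∀ y ∈ A, (x ∈ H ↔ y ∈ H) → (x ∈ B ↔ y ∈ B) := by
  by_cases h : A ⊓ B ≠ ⊥ ∧ A \ B ≠ ⊥
  · refine ⟨A ⊓ B, inf_le_left, fun _ ↦ ⟨h.1, by simpa using h.2⟩, fun x hx y hy hxy ↦ ?_⟩
    have hx' : x ∈ A ⊓ B ↔ x ∈ A ∧ x ∈ B := Iff.rfl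
    have hy' : y ∈ A ⊓ B ↔ y ∈ A ∧ y ∈ B := Iff.rfl
    tauto
  · have hB : ∀ x ∈ A, ∀ y ∈ A, (x ∈ B ↔ y ∈ B) := by
      suffices h' : ∀ x ∈ A, ∀ y ∈ A, x ∈ B → y ∈ B from
        fun x hx y hy ↦ ⟨h' x hx y hy, h' y hy x hx⟩
      intro x hx y hy hxB
      by_contra hyB
      refine h ⟨fun h0 ↦ ?_, fun h0 ↦ ?_⟩
      · have : x ∈ A ⊓ B := ⟨hx, hxB⟩
        rw [h0] at this
        exact this
      · have : y ∈ A \ B := ⟨hy, hyB⟩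
        rw [h0] at this
        exact this
    -- Here `B` does not cut `A`, so any splitting will do; perfectness supplies a second point to
    -- split off.
    by_cases hA : A = ⊥
    · exact ⟨⊥, bot_le, fun h ↦ (h hA).elim, fun x hx y hy _ ↦ hB x hx y hy⟩
    · obtain ⟨x, hx⟩ : (A : Set X).Nonempty := by
        rw [Set.nonempty_iff_ne_empty]
        exact fun h0 ↦ hA (SetLike.coe_injective h0)
      obtain ⟨y, hy, hyx⟩ : ∃ y ∈ A, y ≠ x := by
        have := (A.isClopen.isOpen.mem_nhds hx)
        obtain ⟨y, h1, h2⟩ := (infinite_of_mem_nhds x this).exists_notMem_finset {x}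
        exact ⟨y, h1, by simpa using h2⟩
      obtain ⟨C, hC, hxC, hyC⟩ := exists_isClopen_of_totally_separated hyx.symm
      refine ⟨A ⊓ ⟨C, hC⟩, inf_le_left, fun _ ↦ ⟨fun h0 ↦ ?_, fun h0 ↦ ?_⟩,
        fun x hx y hy _ ↦ hB x hx y hy⟩
      · have : x ∈ A ⊓ ⟨C, hC⟩ := ⟨hx, hxC⟩
        rw [h0] at this
        exact this
      · have : y ∈ A \ (A ⊓ ⟨C, hC⟩) := ⟨hy, fun h ↦ hyC h.2⟩
        rw [h0] at this
        exact this

open Classical in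
/-- The cell containing `x` after `n` steps of the successive splitting rule `H`. -/
noncomputable def splitCell (H : ℕ → Clopens X → Clopens X) (x : X) : ℕ → Clopens X
  | 0 => ⊤
  | n + 1 =>
    if x ∈ H n (splitCell H x n) then H n (splitCell H x n)
    else splitCell H x n \ H n (splitCell H x n)

open Classical in
/-- The itinerary of `x` under the successive splitting rule `H`. -/
noncomputable def splitCode (H : ℕ → Clopens X → Clopens X) (x : X) (n : ℕ) : Bool :=
  decide (x ∈ H n (splitCell H x n))

/-- The cell with itinerary `a` after `n` steps of the successive splitting rule `H`. -/
def splitNode (H : ℕ → Clopens X → Clopens X) (a : ℕ → Bool) : ℕ → Clopens X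
  | 0 => ⊤
  | n + 1 =>
    if a n then H n (splitNode H a n) else splitNode H a n \ H n (splitNode H a n)

variable {H : ℕ → Clopens X → Clopens X}

theorem splitCode_eq_true {x : X} {n : ℕ} :
    splitCode H x n = true ↔ x ∈ H n (splitCell H x n) := by
  simp [splitCode]

theorem splitCell_eq_splitNode (x : X) (n : ℕ) :
    splitCell H x n = splitNode H (splitCode H x) n := by
  induction n with
  | zero => rfl
  | succ n ih =>
    rw [splitCell, splitNode, ← ih]
    classical exact if_congr splitCode_eq_true.symm rfl rfl

theorem mem_splitCell (x : X) (n : ℕ) : x ∈ splitCell H x n := by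
  induction n with
  | zero => exact Set.mem_univ x
  | succ n ih =>
    rw [splitCell]
    split_ifs with h
    · exact h
    · exact ⟨ih, h⟩

theorem splitCell_succ_le (hH : ∀ n A, H n A ≤ A) (x : X) (n : ℕ) :
    splitCell H x (n + 1) ≤ splitCell H x n := by
  rw [splitCell]
  split_ifs with h
  · exact hH _ _
  · exact sdiff_le

theorem splitNode_succ_le (hH : ∀ n A, H n A ≤ A) (a : ℕ → Bool) (n : ℕ) :
    splitNode H a (n + 1) ≤ splitNode H a n := by
  rw [splitNode]
  split_ifs with h
  · exact hH _ _
  · exact sdiff_le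

theorem mem_split_iff_of_mem_splitCell_succ {x y : X} {n : ℕ} (h : y ∈ splitCell H x (n + 1)) :
    y ∈ H n (splitCell H x n) ↔ x ∈ H n (splitCell H x n) := by
  rw [splitCell] at h
  split_ifs at h with h'
  · exact iff_of_true h h'
  · exact iff_of_false h.2 h'

theorem splitCell_eq_of_mem (hH : ∀ n A, H n A ≤ A) {x y : X} {n : ℕ}
    (h : y ∈ splitCell H x n) : splitCell H y n = splitCell H x n := by
  induction n with
  | zero => rfl
  | succ n ih =>
    have h1 := ih (splitCell_succ_le hH x n h)
    have h2 := mem_split_iff_of_mem_splitCell_succ h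
    rw [splitCell, splitCell, h1]
    classical exact if_congr h2 rfl rfl

/-- The `n`-th bit is constant on the clopen cell after `n + 1` steps. -/
theorem continuous_splitCode (hH : ∀ n A, H n A ≤ A) : Continuous (splitCode H) := by
  refine continuous_pi fun n ↦ continuous_iff_continuousAt.2 fun x ↦ ?_
  have : (fun y ↦ splitCode H y n) =ᶠ[𝓝 x] fun _ ↦ splitCode H x n := by
    filter_upwards [(splitCell H x (n + 1)).isClopen.isOpen.mem_nhds (mem_splitCell x (n + 1))]
      with y hy
    have h1 := splitCell_eq_of_mem hH (splitCell_succ_le hH x n hy)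
    have h2 := mem_split_iff_of_mem_splitCell_succ hy
    rw [Bool.eq_iff_iff, splitCode_eq_true, splitCode_eq_true, h1, h2]
  exact continuousAt_const.congr this.symm

theorem splitCode_eq_of_mem_splitNode {x : X} {a : ℕ → Bool} (h : ∀ n, x ∈ splitNode H a n) :
    splitCode H x = a := by
  have key : ∀ n, splitCell H x n = splitNode H a n → splitCode H x n = a n := by
    intro n hn
    have h1 := h (n + 1)
    rw [splitNode] at h1
    rw [Bool.eq_iff_iff, splitCode_eq_true, hn]
    cases ha : a n <;> simp only [ha, if_true, if_false, Bool.false_eq_true] at h1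
    · exact iff_of_false h1.2 Bool.false_ne_true
    · exact iff_of_true h1 rfl
  have cell : ∀ n, splitCell H x n = splitNode H a n := by
    intro n
    induction n with
    | zero => rfl
    | succ n ih =>
      rw [splitCell, splitNode, ← ih, ← key n ih]
      classical exact if_congr splitCode_eq_true.symm rfl rfl
  exact funext fun n ↦ key n (cell n)

/-- A nonempty compact metrizable space that is totally disconnected and has no isolated points
is homeomorphic to the Cantor space. -/
theorem nonempty_homeomorph_natToBool [CompactSpace X] [T2Space X] [SecondCountableTopology X]
    [TotallyDisconnectedSpace X] [PerfectSpace X] [Nonempty X] :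
    Nonempty (X ≃ₜ (ℕ → Bool)) := by
  have : Countable (Clopens X) := Clopens.countable_iff_secondCountable.2 inferInstance
  obtain ⟨B, hB⟩ := exists_surjective_nat (Clopens X)
  choose S hS1 hS2 hS3 using exists_clopens_split (X := X)
  -- Step `n` resolves the `n`-th clopen set, so itineraries separate points; cells never become
  -- empty, so by compactness every itinerary occurs.
  let H : ℕ → Clopens X → Clopens X := fun n A ↦ S A (B n)
  have hH : ∀ n A, H n A ≤ A := fun n A ↦ hS1 A (B n)
  have hinj : Function.Injective (splitCode H) := by
    intro x y hxy
    by_contra hne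
    obtain ⟨C, hC, hxC, hyC⟩ := exists_isClopen_of_totally_separated hne
    obtain ⟨n, hn⟩ := hB ⟨C, hC⟩
    have hcell : splitCell H x n = splitCell H y n := by
      rw [splitCell_eq_splitNode, splitCell_eq_splitNode, hxy]
    have hx := mem_splitCell (H := H) x n
    have hy : y ∈ splitCell H x n := hcell ▸ mem_splitCell y n
    have h := congrFun hxy n
    rw [Bool.eq_iff_iff, splitCode_eq_true, splitCode_eq_true, ← hcell] at h
    have h' := hS3 _ (B n) x hx y hy h
    rw [hn] at h'
    exact hyC (h'.1 hxC)
  have hnode : ∀ a n, splitNode H a n ≠ ⊥ := by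
    intro a n
    induction n with
    | zero =>
      intro h0
      obtain ⟨x⟩ := ‹Nonempty X›
      have : x ∈ splitNode H a 0 := Set.mem_univ x
      rw [h0] at this
      exact this
    | succ n ih =>
      rw [splitNode]
      split_ifs
      · exact (hS2 _ _ ih).1
      · exact (hS2 _ _ ih).2
  have hsurj : Function.Surjective (splitCode H) := by
    intro a
    obtain ⟨x, hx⟩ := IsCompact.nonempty_iInter_of_sequence_nonempty_isCompact_isClosed
      (fun n ↦ (splitNode H a n : Set X)) (fun n ↦ splitNode_succ_le hH a n)
      (fun n ↦ by
        rw [Set.nonempty_iff_ne_empty]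
        exact fun h0 ↦ hnode a n (SetLike.coe_injective h0))
      (splitNode H a 0).isClopen.isClosed.isCompact (fun n ↦ (splitNode H a n).isClopen.isClosed)
    exact ⟨x, splitCode_eq_of_mem_splitNode fun n ↦ Set.mem_iInter.1 hx n⟩
  exact ⟨(continuous_splitCode hH).homeoOfEquivCompactToT2
    (f := Equiv.ofBijective _ ⟨hinj, hsurj⟩)⟩

end Brouwer

/-! ### Intrinsic description of Cantor sets -/

instance perfectSpace_natToBool : PerfectSpace (ℕ → Bool) := by
  rw [perfectSpace_iff_forall_not_isolated]
  intro x
  have hlim : Tendsto (fun n ↦ Function.update x n (!x n)) atTop (𝓝[≠] x) := by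
    refine tendsto_nhdsWithin_iff.2 ⟨tendsto_pi_nhds.2 fun k ↦ ?_, Eventually.of_forall fun n h ↦ ?_⟩
    · refine tendsto_const_nhds.congr' ?_
      filter_upwards [eventually_gt_atTop k] with n hn
      rw [Function.update_of_ne hn.ne]
    · have := congrFun h n
      simp at this
  exact hlim.neBot

theorem perfectSpace_iff_not_isOpen_singleton {X : Type*} [TopologicalSpace X] :
    PerfectSpace X ↔ ∀ x : X, ¬ IsOpen {x} := by
  simp only [perfectSpace_iff_forall_not_isolated, isOpen_singleton_iff_punctured_nhds, neBot_iff,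
    ne_eq]

theorem Homeomorph.perfectSpace {X Y : Type*} [TopologicalSpace X] [TopologicalSpace Y]
    [PerfectSpace X] (e : X ≃ₜ Y) : PerfectSpace Y := by
  rw [perfectSpace_iff_not_isOpen_singleton]
  intro y hy
  refine perfectSpace_iff_not_isOpen_singleton.1 ‹PerfectSpace X› (e.symm y) ?_
  rw [← Set.image_singleton]
  exact e.symm.isOpenMap _ hy

/-- A subset of a metric space is a Cantor set iff it is nonempty, compact, totally disconnected
and without isolated points. -/
theorem isCantorSet_iff {X : Type*} [TopologicalSpace X] [MetrizableSpace X] {s : Set X} :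
    IsCantorSet s ↔ Nonempty s ∧ CompactSpace s ∧ TotallyDisconnectedSpace s ∧ PerfectSpace s := by
  constructor
  · rintro ⟨e⟩
    let e' := e.trans cantorSetHomeomorphNatToBool
    exact ⟨⟨e'.symm fun _ ↦ true⟩, e'.symm.compactSpace, e'.symm.totallyDisconnectedSpace,
      e'.symm.perfectSpace⟩
  · rintro ⟨_, _, _, _⟩
    obtain ⟨e⟩ := nonempty_homeomorph_natToBool (X := s)
    exact ⟨e.trans cantorSetHomeomorphNatToBool.symm⟩

/-! ### Cantor sets as a Gδ in the hyperspace -/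

section Hyperspace

variable {X : Type*} [MetricSpace X]

/-- If a property of pairs (compact set, tuple of points) is open, then so is the property of a
compact set that all tuples of its points satisfy it. -/
theorem isOpen_setOf_forall_tuple_mem {ι : Type*} [Fintype ι]
    {O : Set (NonemptyCompacts X × (ι → X))} (hO : IsOpen O) :
    IsOpen {K : NonemptyCompacts X | ∀ p : ι → X, (∀ i, p i ∈ K) → (K, p) ∈ O} := by
  rw [Metric.isOpen_iff]
  intro K hK
  -- Tube argument: a compact set inside an open one has a uniform thickening inside it, and tuples
  -- from a nearby `L` are close to tuples from `K`.
  have hc : IsCompact (({K} : Set (NonemptyCompacts X)) ×ˢ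
      Set.univ.pi fun _ : ι ↦ (K : Set X)) :=
    isCompact_singleton.prod (isCompact_univ_pi fun _ ↦ K.isCompact)
  obtain ⟨ε, hε, hsub⟩ := hc.exists_thickening_subset_open hO (by
    rintro ⟨L, p⟩ ⟨hL, hp⟩
    obtain rfl : L = K := hL
    exact hK p fun i ↦ hp i (Set.mem_univ i))
  refine ⟨ε, hε, fun L hL p hp ↦ hsub ?_⟩
  have hfin : Metric.hausdorffEDist (L : Set X) K ≠ ⊤ :=
    Metric.hausdorffEDist_ne_top_of_nonempty_of_bounded L.nonempty K.nonempty
      L.isCompact.isBounded K.isCompact.isBounded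
  have h : ∀ i, ∃ y ∈ (K : Set X), dist (p i) y < ε := fun i ↦
    Metric.exists_dist_lt_of_hausdorffDist_lt (hp i) hL hfin
  choose q hqK hq using h
  refine Metric.mem_thickening_iff.2 ⟨(K, q), ⟨rfl, fun i _ ↦ hqK i⟩, ?_⟩
  rw [Prod.dist_eq]
  exact max_lt hL ((dist_pi_lt_iff hε).2 hq)

/-- Compact sets in which points at distance at least `δ` can be separated. -/
def separatedAtScale (X : Type*) [MetricSpace X] (δ : ℝ) : Set (NonemptyCompacts X) :=
  {K | ∀ p : Bool → X, (∀ i, p i ∈ K) → dist (p true) (p false) < δ ∨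
    ∃ U V : Set X, IsOpen U ∧ IsOpen V ∧ Disjoint U V ∧ (K : Set X) ⊆ U ∪ V ∧
      p true ∈ U ∧ p false ∈ V}

/-- Compact sets in which every point has a different point at distance less than `δ`. -/
def crowdedAtScale (X : Type*) [MetricSpace X] (δ : ℝ) : Set (NonemptyCompacts X) :=
  {K | ∀ p : Unit → X, (∀ i, p i ∈ K) → ∃ y ∈ K, y ≠ p () ∧ dist y (p ()) < δ}

/-- The same `U` and `V` still work after a small change of the compact set and of the two points.
-/
theorem isOpen_separatedAtScale (δ : ℝ) : IsOpen (separatedAtScale X δ) := by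
  refine isOpen_setOf_forall_tuple_mem (O := {q | dist (q.2 true) (q.2 false) < δ ∨
    ∃ U V : Set X, IsOpen U ∧ IsOpen V ∧ Disjoint U V ∧ (q.1 : Set X) ⊆ U ∪ V ∧
      q.2 true ∈ U ∧ q.2 false ∈ V}) ?_
  rw [Set.ofPred_or]
  refine IsOpen.union (isOpen_lt (f := fun q : NonemptyCompacts X × (Bool → X) ↦
    dist (q.2 true) (q.2 false)) (by fun_prop) continuous_const) ?_
  rw [isOpen_iff_mem_nhds]
  rintro ⟨K, p⟩ ⟨U, V, hU, hV, hUV, hK, h1, h2⟩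
  have e1 : ∀ᶠ q : NonemptyCompacts X × (Bool → X) in 𝓝 (K, p), (q.1 : Set X) ⊆ U ∪ V :=
    continuous_fst.continuousAt.eventually
      ((NonemptyCompacts.isOpen_subsets_of_isOpen (hU.union hV)).mem_nhds hK)
  have e2 : ∀ᶠ q : NonemptyCompacts X × (Bool → X) in 𝓝 (K, p), q.2 true ∈ U :=
    (hU.preimage (by fun_prop : Continuous fun q : NonemptyCompacts X × (Bool → X) ↦
      q.2 true)).mem_nhds h1
  have e3 : ∀ᶠ q : NonemptyCompacts X × (Bool → X) in 𝓝 (K, p), q.2 false ∈ V :=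
    (hV.preimage (by fun_prop : Continuous fun q : NonemptyCompacts X × (Bool → X) ↦
      q.2 false)).mem_nhds h2
  filter_upwards [e1, e2, e3] with q hq1 hq2 hq3
  exact ⟨U, V, hU, hV, hUV, hq1, hq2, hq3⟩

theorem isOpen_crowdedAtScale (δ : ℝ) : IsOpen (crowdedAtScale X δ) := by
  refine isOpen_setOf_forall_tuple_mem
    (O := {q | ∃ y ∈ q.1, y ≠ q.2 () ∧ dist y (q.2 ()) < δ}) ?_
  rw [isOpen_iff_mem_nhds]
  rintro ⟨K, p⟩ ⟨y, hyK, hyp, hyδ⟩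
  have e : ∀ᶠ r : X × X in 𝓝 (y, p ()), r.1 ≠ r.2 ∧ dist r.1 r.2 < δ :=
    ((isOpen_ne_fun continuous_fst continuous_snd).inter
      (isOpen_lt continuous_dist continuous_const)).mem_nhds ⟨hyp, hyδ⟩
  rw [nhds_prod_eq] at e
  obtain ⟨U, hU, V, hV, hUV⟩ := eventually_prod_iff.1 e
  obtain ⟨U', hU', hU'o, hyU'⟩ := mem_nhds_iff.1 hU
  have e1 : ∀ᶠ q : NonemptyCompacts X × (Unit → X) in 𝓝 (K, p),
      ((q.1 : Set X) ∩ U').Nonempty :=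
    continuous_fst.continuousAt.eventually
      ((NonemptyCompacts.isOpen_inter_nonempty_of_isOpen hU'o).mem_nhds ⟨y, hyK, hyU'⟩)
  have e2 : ∀ᶠ q : NonemptyCompacts X × (Unit → X) in 𝓝 (K, p), V (q.2 ()) :=
    (by fun_prop : Continuous fun q : NonemptyCompacts X × (Unit → X) ↦
      q.2 ()).continuousAt.eventually hV
  filter_upwards [e1, e2] with q ⟨z, hz, hzU⟩ hq2
  exact ⟨z, hz, hUV (hU' hzU) hq2⟩

theorem exists_separatedNhds_of_totallyDisconnected {s : Set X} [CompactSpace s]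
    [TotallyDisconnectedSpace s] {x y : X} (hx : x ∈ s) (hy : y ∈ s) (hxy : x ≠ y) :
    ∃ U V : Set X, IsOpen U ∧ IsOpen V ∧ Disjoint U V ∧ s ⊆ U ∪ V ∧ x ∈ U ∧ y ∈ V := by
  obtain ⟨C, hC, hxC, hyC⟩ := exists_isClopen_of_totally_separated
    (i := (⟨x, hx⟩ : s)) (j := ⟨y, hy⟩) (by simpa using hxy)
  obtain ⟨U, V, hU, hV, hCU, hCV, hUV⟩ := SeparatedNhds.of_isCompact_isCompact
    (hC.isClosed.isCompact.image continuous_subtype_val)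
    (hC.compl.isClosed.isCompact.image continuous_subtype_val)
    ((Set.disjoint_image_iff Subtype.val_injective).2 disjoint_compl_right)
  refine ⟨U, V, hU, hV, hUV, fun z hz ↦ ?_, hCU ⟨_, hxC, rfl⟩, hCV ⟨_, hyC, rfl⟩⟩
  by_cases h : (⟨z, hz⟩ : s) ∈ C
  · exact Or.inl (hCU ⟨_, h, rfl⟩)
  · exact Or.inr (hCV ⟨_, h, rfl⟩)

theorem mem_separatedAtScale_of_totallyDisconnected {K : NonemptyCompacts X}
    (hK : TotallyDisconnectedSpace (K : Set X)) {δ : ℝ} (hδ : 0 < δ) :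
    K ∈ separatedAtScale X δ := by
  intro p hp
  by_cases h : p true = p false
  · left
    rwa [h, dist_self]
  · have : CompactSpace (K : Set X) := isCompact_iff_compactSpace.1 K.isCompact
    exact Or.inr (exists_separatedNhds_of_totallyDisconnected (hp true) (hp false) h)

theorem totallyDisconnectedSpace_of_mem_separatedAtScale {K : NonemptyCompacts X}
    (hK : ∀ n : ℕ, K ∈ separatedAtScale X (1 / (n + 1))) :
    TotallyDisconnectedSpace (K : Set X) := by
  rw [totallyDisconnectedSpace_subtype_iff]
  intro t ht htc x hx y hy
  by_contra hxy
  obtain ⟨n, hn⟩ := exists_nat_one_div_lt (dist_pos.2 hxy)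
  rcases hK n (fun b ↦ if b then x else y) (by
    intro b
    cases b
    · exact ht hy
    · exact ht hx) with h | ⟨U, V, hU, hV, hUV, hKUV, h1, h2⟩
  · exact absurd h (by simpa using hn.le)
  · obtain ⟨z, -, hz⟩ := htc U V hU hV (ht.trans hKUV) ⟨x, hx, by simpa using h1⟩
      ⟨y, hy, by simpa using h2⟩
    exact Set.disjoint_left.1 hUV hz.1 hz.2

theorem perfectSpace_iff_mem_crowdedAtScale {K : NonemptyCompacts X} :
    PerfectSpace (K : Set X) ↔ ∀ n : ℕ, K ∈ crowdedAtScale X (1 / (n + 1)) := by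
  rw [perfectSpace_iff_not_isOpen_singleton]
  constructor
  · intro h n p hp
    by_contra! hcon
    refine h ⟨p (), hp ()⟩ (Metric.isOpen_iff.2 ?_)
    rintro _ rfl
    refine ⟨1 / (n + 1), by positivity, fun y hy ↦ ?_⟩
    by_contra hne
    exact (hcon y y.2 fun h ↦ hne (Subtype.ext h)).not_gt hy
  · intro h x hx
    obtain ⟨ε, hε, hsub⟩ := Metric.isOpen_iff.1 hx x rfl
    obtain ⟨n, hn⟩ := exists_nat_one_div_lt hε
    obtain ⟨y, hyK, hyx, hy⟩ := h n (fun _ ↦ x) fun _ ↦ x.2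
    exact hyx (congrArg Subtype.val (hsub (show (⟨y, hyK⟩ : (K : Set X)) ∈ _ from hy.trans hn)))

/-- The Cantor sets form a countable intersection of open sets in the hyperspace. -/
theorem setOf_isCantorSet_eq :
    {K : NonemptyCompacts X | IsCantorSet (K : Set X)} =
      ⋂ n : ℕ, separatedAtScale X (1 / (n + 1)) ∩ crowdedAtScale X (1 / (n + 1)) := by
  ext K
  have : CompactSpace (K : Set X) := isCompact_iff_compactSpace.1 K.isCompact
  have : Nonempty (K : Set X) := K.nonempty.to_subtype
  simp only [Set.mem_ofPred_eq, isCantorSet_iff, Set.mem_iInter, Set.mem_inter_iff, forall_and,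
    perfectSpace_iff_mem_crowdedAtScale]
  constructor
  · rintro ⟨-, -, h1, h2⟩
    exact ⟨fun n ↦ mem_separatedAtScale_of_totallyDisconnected h1 (by positivity), h2⟩
  · rintro ⟨h1, h2⟩
    exact ⟨inferInstance, inferInstance, totallyDisconnectedSpace_of_mem_separatedAtScale h1, h2⟩

/-- Finite sets are dense and totally disconnected. -/
theorem dense_separatedAtScale {δ : ℝ} (hδ : 0 < δ) : Dense (separatedAtScale X δ) := by
  refine NonemptyCompacts.dense_setOfPred_finite.mono fun K hK ↦ ?_
  refine mem_separatedAtScale_of_totallyDisconnected ?_ hδ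
  exact totallyDisconnectedSpace_subtype_iff.2 (Set.Finite.countable hK).isTotallyDisconnected

end Hyperspace

/-- Adjoining to `K` its translate by a small non-zero `w` gives every point a companion at distance
`‖w‖`. -/
theorem dense_crowdedAtScale {E : Type*} [NormedAddCommGroup E] [NormedSpace ℝ E] [Nontrivial E]
    {δ : ℝ} (hδ : 0 < δ) : Dense (crowdedAtScale E δ) := by
  intro K
  let Φ : E → NonemptyCompacts E := fun w ↦
    K ⊔ K.map (fun x ↦ x + w) (by fun_prop)
  have hΦ : Continuous Φ := by
    refine continuous_const.sup ?_
    exact Continuous.nonemptyCompacts_map' (g := fun w x : E ↦ x + w) continuous_const (by fun_prop)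
  have h0 : Φ 0 = K := by
    apply SetLike.coe_injective
    simp [Φ]
  have : PerfectSpace E := perfectSpace_of_module ℝ E
  have hlim : Tendsto Φ (𝓝[≠] 0) (𝓝 K) := by
    have := (hΦ.tendsto 0).mono_left (nhdsWithin_le_nhds (s := {0}ᶜ))
    rwa [h0] at this
  refine mem_closure_of_tendsto hlim ?_
  filter_upwards [self_mem_nhdsWithin, nhdsWithin_le_nhds (Metric.ball_mem_nhds (0 : E) hδ)]
    with w hw0 hwδ
  rintro p hp
  rw [mem_ball_zero_iff] at hwδ
  rcases hp () with h | ⟨x, hx, hxp⟩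
  · exact ⟨p () + w, Or.inr ⟨_, h, rfl⟩, by simpa using hw0, by simpa using hwδ⟩
  · have hxp : x + w = p () := hxp
    refine ⟨x, Or.inl hx, ?_, ?_⟩ <;> rw [← hxp]
    · simpa using hw0
    · simpa using hwδ

/-! ### General position of typical Cantor sets -/

section GeneralPosition

variable {E : Type*} [NormedAddCommGroup E] [NormedSpace ℝ E]

/-- Applying a left inverse `g` of the combination map of `b` to a relation `c` for `a + t • b`
yields `A c = -t c`, and `A` has finitely many eigenvalues. -/
theorem eventually_linearIndependent_add_smul {ι : Type*} [Fintype ι] (a : ι → E) {b : ι → E}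
    (hb : LinearIndependent ℝ b) :
    ∀ᶠ t in 𝓝[≠] (0 : ℝ), LinearIndependent ℝ (a + t • b) := by
  obtain ⟨g, hg⟩ := LinearMap.exists_leftInverse_of_injective (Fintype.linearCombination ℝ b)
    (LinearMap.ker_eq_bot.2 hb.fintypeLinearCombination_injective)
  let A : Module.End ℝ (ι → ℝ) := g ∘ₗ Fintype.linearCombination ℝ a
  have hfin : {t : ℝ | A.HasEigenvalue (-t)}.Finite :=
    A.finite_hasEigenvalue.preimage neg_injective.injOn
  -- Zero may itself be an eigenvalue; it is removed because only `t ≠ 0` matters.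
  have hnhds : ({t : ℝ | A.HasEigenvalue (-t)} \ {0})ᶜ ∈ 𝓝 (0 : ℝ) :=
    (hfin.subset Set.sdiff_subset).isClosed.isOpen_compl.mem_nhds fun h ↦ h.2 rfl
  filter_upwards [nhdsWithin_le_nhds hnhds, self_mem_nhdsWithin] with t ht ht0
  have ht' : ¬ A.HasEigenvalue (-t) := fun h ↦ ht ⟨h, ht0⟩
  rw [Fintype.linearIndependent_iff]
  intro c hc
  by_contra! hne
  refine ht' (Module.End.hasEigenvalue_of_hasEigenvector (x := c)
    ⟨Module.End.mem_eigenspace_iff.2 ?_, fun h0 ↦ ?_⟩)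
  · have hgb : g (∑ i, c i • b i) = c := by
      have := LinearMap.congr_fun hg c
      simpa [Fintype.linearCombination_apply] using this
    have h1 : ∑ i, c i • a i + t • ∑ i, c i • b i = 0 := by
      rw [← hc, Finset.smul_sum, ← Finset.sum_add_distrib]
      refine Finset.sum_congr rfl fun i _ ↦ ?_
      simp [smul_add, smul_comm t]
    have h2 := congrArg g h1
    rw [map_add, map_smul, hgb, map_zero] at h2
    simpa [A, Fintype.linearCombination_apply] using eq_neg_of_add_eq_zero_left h2
  · obtain ⟨i, hi⟩ := hne
    exact hi (congrFun h0 i)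

/-- Any `n` differences of `2 * n` distinct points of `s`, grouped into pairs, are linearly
independent. -/
def PairwiseGeneric (n : ℕ) (s : Set E) : Prop :=
  ∀ p : Fin n × Bool → E, Function.Injective p → (∀ i, p i ∈ s) →
    LinearIndependent ℝ fun i ↦ p (i, true) - p (i, false)

/-- Compact sets for which the condition in `PairwiseGeneric` holds for points with mutual
distances at least `δ`. -/
def genericAtScale (E : Type*) [NormedAddCommGroup E] [NormedSpace ℝ E] (n : ℕ) (δ : ℝ) :
    Set (NonemptyCompacts E) :=
  {K | ∀ p : Fin n × Bool → E, (∀ i, p i ∈ K) → (∃ i j, i ≠ j ∧ dist (p i) (p j) < δ) ∨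
    LinearIndependent ℝ fun i ↦ p (i, true) - p (i, false)}

theorem isOpen_genericAtScale (n : ℕ) (δ : ℝ) : IsOpen (genericAtScale E n δ) := by
  refine isOpen_setOf_forall_tuple_mem (O := {q | (∃ i j, i ≠ j ∧ dist (q.2 i) (q.2 j) < δ) ∨
    LinearIndependent ℝ fun i ↦ q.2 (i, true) - q.2 (i, false)}) ?_
  rw [Set.ofPred_or]
  refine IsOpen.union ?_ ?_
  · have : {q : NonemptyCompacts E × (Fin n × Bool → E) |
        ∃ i j, i ≠ j ∧ dist (q.2 i) (q.2 j) < δ} =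
        ⋃ (i) (j) (_ : i ≠ j), {q | dist (q.2 i) (q.2 j) < δ} := by
      ext q
      simp
    rw [this]
    exact isOpen_iUnion fun i ↦ isOpen_iUnion fun j ↦ isOpen_iUnion fun _ ↦
      isOpen_lt (f := fun q : NonemptyCompacts E × (Fin n × Bool → E) ↦ dist (q.2 i) (q.2 j))
        (by fun_prop) continuous_const
  · exact isOpen_setOfPred_linearIndependent.preimage
      (f := fun (q : NonemptyCompacts E × (Fin n × Bool → E)) (i : Fin n) ↦
        q.2 (i, true) - q.2 (i, false)) (by fun_prop)

theorem pairwiseGeneric_of_mem_genericAtScale {n : ℕ} {K : NonemptyCompacts E}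
    (hK : ∀ m : ℕ, K ∈ genericAtScale E n (1 / (m + 1))) : PairwiseGeneric n (K : Set E) := by
  intro p hp hpK
  by_contra hli
  have h : ∀ m : ℕ, ∃ i j, i ≠ j ∧ dist (p i) (p j) < 1 / ((m : ℝ) + 1) :=
    fun m ↦ (hK m p hpK).resolve_right hli
  obtain ⟨m, hm⟩ : ∃ m : ℕ, ∀ i j, i ≠ j → 1 / ((m : ℝ) + 1) < dist (p i) (p j) := by
    have : ∀ᶠ m : ℕ in atTop, ∀ i j, i ≠ j → 1 / ((m : ℝ) + 1) < dist (p i) (p j) := by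
      simp only [eventually_all]
      exact fun i j hij ↦ tendsto_one_div_add_atTop_nhds_zero_nat.eventually
        (gt_mem_nhds (dist_pos.2 (hp.ne hij)))
    exact this.exists
  obtain ⟨i, j, hij, hlt⟩ := h m
  exact (hm i j hij).not_gt hlt

theorem dense_setOf_linearIndependent_sub {ι : Type*} [Fintype ι] {n : ℕ} {b : Fin n → E}
    (hb : LinearIndependent ℝ b) {q : Fin n × Bool → ι} (hq : Function.Injective q) :
    Dense {x : ι → E | LinearIndependent ℝ fun i ↦ x (q (i, true)) - x (q (i, false))} := by
  intro x
  -- Moving only the first point of each pair changes the `i`-th difference by exactly `t • b i`.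
  let y : ι → E := Function.extend q (fun i ↦ if i.2 then b i.1 else 0) 0
  have hlim : Tendsto (fun t : ℝ ↦ x + t • y) (𝓝[≠] 0) (𝓝 x) := by
    have : Continuous fun t : ℝ ↦ x + t • y := by fun_prop
    simpa using (this.tendsto 0).mono_left (nhdsWithin_le_nhds (s := {0}ᶜ))
  refine mem_closure_of_tendsto hlim ?_
  filter_upwards [eventually_linearIndependent_add_smul
    (fun i ↦ x (q (i, true)) - x (q (i, false))) hb] with t ht
  have : (fun i ↦ (x + t • y) (q (i, true)) - (x + t • y) (q (i, false))) =
      (fun i ↦ x (q (i, true)) - x (q (i, false))) + t • b := by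
    ext i
    simp only [Pi.add_apply, Pi.smul_apply, y, hq.extend_apply]
    simp only [if_true, Bool.false_eq_true, if_false, smul_zero]
    abel
  exact this ▸ ht

/-- Only finitely many injective choices of indices from a finite `F` occur, so one arbitrarily
small perturbation of its points handles all of them. -/
theorem dense_genericAtScale [CompleteSpace E] {n : ℕ} {b : Fin n → E}
    (hb : LinearIndependent ℝ b) {δ : ℝ} (hδ : 0 < δ) : Dense (genericAtScale E n δ) := by
  refine dense_closure.1 (NonemptyCompacts.dense_setOfPred_finite.mono fun F hF ↦ ?_)
  have hfin : (F : Set E).Finite := hF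
  have : Fintype (F : Set E) := hfin.fintype
  have : Nonempty (F : Set E) := F.nonempty.to_subtype
  let Φ : (↥(F : Set E) → E) → NonemptyCompacts E := fun x ↦
    ⟨⟨Set.range x, (Set.finite_range x : (Set.range x).Finite).isCompact⟩, Set.range_nonempty x⟩
  have hΦ : Continuous Φ := by
    let _ : TopologicalSpace (Set E) := TopologicalSpace.vietoris E
    exact NonemptyCompacts.isEmbedding_coe.continuous_iff.2 vietoris.continuous_range_of_finite
  have hF' : Φ Subtype.val = F := SetLike.coe_injective Subtype.range_coe
  have hdense : Dense (⋂ q : {q : Fin n × Bool → (F : Set E) // Function.Injective q},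
      {x : ↥(F : Set E) → E | LinearIndependent ℝ fun i ↦
        x (q.1 (i, true)) - x (q.1 (i, false))}) := by
    refine dense_iInter_of_isOpen (fun q ↦ ?_) fun q ↦ dense_setOf_linearIndependent_sub hb q.2
    exact isOpen_setOfPred_linearIndependent.preimage
      (f := fun (x : ↥(F : Set E) → E) (i : Fin n) ↦ x (q.1 (i, true)) - x (q.1 (i, false)))
      (by fun_prop)
  rw [← hF']
  refine map_mem_closure hΦ (hdense _) fun x hx p hp ↦ ?_
  -- A repeated point gives distance `0 < δ`; otherwise the indices of the points of `p` are
  -- distinct, even if `x` is not injective.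
  by_cases hinj : Function.Injective p
  · right
    choose q hq using hp
    obtain rfl : x ∘ q = p := funext hq
    exact Set.mem_iInter.1 hx ⟨q, hinj.of_comp⟩
  · left
    obtain ⟨i, j, hij, hne⟩ := Function.not_injective_iff.1 hinj
    exact ⟨i, j, hne, by rwa [hij, dist_self]⟩

theorem dense_setOf_isCantorSet [CompleteSpace E] [Nontrivial E] :
    Dense {K : NonemptyCompacts E | IsCantorSet (K : Set E)} := by
  rw [setOf_isCantorSet_eq]
  refine dense_iInter_of_isOpen
    (fun n ↦ (isOpen_separatedAtScale _).inter (isOpen_crowdedAtScale _)) fun n ↦ ?_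
  exact (dense_separatedAtScale (by positivity)).inter_of_isOpen_left
    (dense_crowdedAtScale (by positivity)) (isOpen_separatedAtScale _)

theorem isGδ_setOf_isCantorSet {X : Type*} [MetricSpace X] :
    IsGδ {K : NonemptyCompacts X | IsCantorSet (K : Set X)} := by
  rw [setOf_isCantorSet_eq]
  exact .iInter_of_isOpen fun n ↦ (isOpen_separatedAtScale _).inter (isOpen_crowdedAtScale _)

/-- A typical Cantor set is pairwise generic, for every size that the dimension admits. -/
theorem typical_pairwiseGeneric [CompleteSpace E] [Nontrivial E] :
    Typical (CantorSets E) fun K ↦ ∀ n : ℕ, (∃ b : Fin n → E, LinearIndependent ℝ b) →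
      PairwiseGeneric n (K.1 : Set E) := by
  have hD := dense_setOf_isCantorSet (E := E)
  refine ⟨hD.nonempty.to_subtype, isGδ_setOf_isCantorSet.baireSpace_of_dense hD, ?_⟩
  have key : ∀ n m : ℕ, (∃ b : Fin n → E, LinearIndependent ℝ b) →
      {K : CantorSets E | K.1 ∈ genericAtScale E n (1 / (m + 1))} ∈ residual (CantorSets E) := by
    rintro n m ⟨b, hb⟩
    have hopen := isOpen_genericAtScale (E := E) n (1 / (m + 1))
    refine residual_of_dense_open (hopen.preimage continuous_subtype_val) ?_
    refine Subtype.dense_iff.2 fun K _ ↦ ?_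
    have := (dense_genericAtScale hb (δ := 1 / ((m : ℝ) + 1)) (by positivity)).inter_of_isOpen_left
      hD hopen K
    refine closure_mono ?_ this
    rintro L ⟨hL, hL'⟩
    exact ⟨⟨L, hL'⟩, hL, rfl⟩
  have hall : ∀ᶠ K in residual (CantorSets E), ∀ n m : ℕ,
      (∃ b : Fin n → E, LinearIndependent ℝ b) → K.1 ∈ genericAtScale E n (1 / (m + 1)) := by
    simp only [eventually_countable_forall]
    exact key
  filter_upwards [hall] with K hK n hn
  exact pairwiseGeneric_of_mem_genericAtScale fun m ↦ hK n m hn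

end GeneralPosition

/-! ### Maps with finitely many identifications -/

section FinitelyManyIdentifications

variable {X Y : Type*} [TopologicalSpace X] [TopologicalSpace Y] {f : X → Y}

/-- A nontrivial connected set is infinite, so it contains some `f k` with `k` not identified with
any other point. A clopen `A` around `k` avoiding all identified points is saturated, so `f '' A` is
clopen; excluding `m` from `A` lets it separate `f k` from `f m`. -/
theorem totallyDisconnectedSpace_of_finite_identifications [CompactSpace X] [T2Space X]
    [T2Space Y] [TotallyDisconnectedSpace X]
    (hf : Continuous f) (hsurj : Function.Surjective f)
    (hfin : {x | ∃ y, y ≠ x ∧ f y = f x}.Finite) : TotallyDisconnectedSpace Y := by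
  refine ⟨fun t _ ht ↦ ?_⟩
  by_contra hnt
  rw [Set.not_subsingleton_iff] at hnt
  obtain ⟨c, hct, hc⟩ := (ht.infinite_of_nontrivial hnt).exists_notMem_finite (hfin.image f)
  obtain ⟨d, hdt, hdc⟩ := hnt.exists_ne c
  obtain ⟨k, rfl⟩ := hsurj c
  obtain ⟨m, rfl⟩ := hsurj d
  obtain ⟨A, hA, hkA, hAsub⟩ := compact_exists_isClopen_in_isOpen
    (hfin.union (Set.finite_singleton m)).isClosed.isOpen_compl (x := k) (by
      rintro (hk | hk)
      · exact hc ⟨k, hk, rfl⟩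
      · exact hdc (congrArg f hk).symm)
  have hcompl : (f '' A)ᶜ = f '' Aᶜ := by
    ext y
    constructor
    · intro hy
      obtain ⟨x, rfl⟩ := hsurj y
      exact ⟨x, fun hx ↦ hy ⟨x, hx, rfl⟩, rfl⟩
    · rintro ⟨x, hx, rfl⟩ ⟨a, ha, hax⟩
      exact hAsub ha (Or.inl ⟨x, fun h ↦ hx (h ▸ ha), hax.symm⟩)
  have hclopen : IsClopen (f '' A) :=
    ⟨hf.isClosedMap _ hA.isClosed, by
      rw [← isClosed_compl_iff, hcompl]
      exact hf.isClosedMap _ hA.compl.isClosed⟩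
  obtain ⟨a, ha, ham⟩ := ht.subset_isClopen hclopen ⟨f k, hct, k, hkA, rfl⟩ hdt
  by_cases h : m = a
  · exact hAsub ha (Or.inr h.symm)
  · exact hAsub ha (Or.inl ⟨m, h, ham.symm⟩)

/-- The fibre over an isolated point would be open, hence infinite, yet all but one of its points
are among the finitely many identified ones. -/
theorem perfectSpace_of_finite_identifications [T1Space X] [PerfectSpace X]
    (hf : Continuous f) (hsurj : Function.Surjective f)
    (hfin : {x | ∃ y, y ≠ x ∧ f y = f x}.Finite) : PerfectSpace Y := by
  rw [perfectSpace_iff_not_isOpen_singleton]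
  intro y hy
  obtain ⟨x, rfl⟩ := hsurj y
  have hinf := infinite_of_mem_nhds x ((hy.preimage hf).mem_nhds rfl)
  refine hinf ((hfin.union (Set.finite_singleton x)).subset fun z hz ↦ ?_)
  by_cases h : x = z
  · exact Or.inr h.symm
  · exact Or.inl ⟨x, h, (show f z = f x from hz).symm⟩

end FinitelyManyIdentifications

theorem IsCantorSet.image_of_finite_identifications {X Y : Type*} [MetricSpace X] [MetricSpace Y]
    {s : Set X} (hs : IsCantorSet s) {f : X → Y} (hf : Continuous f)
    (hfin : {x | x ∈ s ∧ ∃ y ∈ s, y ≠ x ∧ f y = f x}.Finite) : IsCantorSet (f '' s) := by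
  obtain ⟨_, _, _, _⟩ := isCantorSet_iff.1 hs
  let g : s → f '' s := Set.imageFactorization f s
  have hg : Continuous g := (hf.comp continuous_subtype_val).subtype_mk _
  have hsurj : Function.Surjective g := Set.imageFactorization_surjective
  have hgfin : {x | ∃ y, y ≠ x ∧ g y = g x}.Finite := by
    refine (hfin.preimage (f := Subtype.val) Subtype.val_injective.injOn).subset ?_
    rintro x ⟨y, hyx, h⟩
    exact ⟨x.2, y, y.2, fun h ↦ hyx (Subtype.ext h), congrArg Subtype.val h⟩
  exact isCantorSet_iff.2 ⟨Nonempty.map g inferInstance,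
    isCompact_iff_compactSpace.1 ((isCompact_iff_compactSpace.2 ‹_›).image hf),
    totallyDisconnectedSpace_of_finite_identifications hg hsurj hgfin,
    perfectSpace_of_finite_identifications hg hsurj hgfin⟩

/-- If a map identifies infinitely many points of `s` with other points of `s`, then it identifies
the points in arbitrarily many disjoint pairs. -/
theorem exists_injective_pairs_of_infinite {X Y : Type*} {s : Set X} {f : X → Y}
    (hinf : {x | x ∈ s ∧ ∃ y ∈ s, y ≠ x ∧ f y = f x}.Infinite) (n : ℕ) :
    ∃ p : Fin n × Bool → X, Function.Injective p ∧ (∀ i, p i ∈ s) ∧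
      ∀ i, f (p (i, true)) = f (p (i, false)) := by
  induction n with
  | zero => exact ⟨fun i ↦ i.1.elim0, fun i ↦ i.1.elim0, fun i ↦ i.1.elim0, fun i ↦ i.elim0⟩
  | succ n ih =>
    obtain ⟨p, hp, hps, hpf⟩ := ih
    -- If no fresh pair existed, each fibre would have at most one point of `s` outside `range p`,
    -- and every identified point would lie in `range p` or in the fibre of one of its points: a
    -- finite set.
    obtain ⟨x, hx, y, hy, hxy, hfxy, hxp, hyp⟩ : ∃ x ∈ s, ∃ y ∈ s, x ≠ y ∧ f x = f y ∧
        x ∉ Set.range p ∧ y ∉ Set.range p := by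
      by_contra! hcon
      have hR := Set.finite_range p
      have hfib : ∀ z, {x | x ∈ s ∧ x ∉ Set.range p ∧ f x = f z}.Finite := fun z ↦
        Set.Subsingleton.finite fun x hx y hy ↦ by
          by_contra hne
          exact hy.2.1 (hcon x hx.1 y hy.1 hne (hx.2.2.trans hy.2.2.symm) hx.2.1)
      refine hinf ((hR.union (hR.biUnion fun z _ ↦ hfib z)).subset ?_)
      rintro x ⟨hx, y, hy, hyx, hf⟩
      by_cases hxp : x ∈ Set.range p
      · exact Or.inl hxp
      · exact Or.inr (Set.mem_biUnion (hcon x hx y hy hyx.symm hf.symm hxp) ⟨hx, hxp, hf.symm⟩)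
    refine ⟨fun i ↦ Fin.cases (if i.2 then x else y) (fun j ↦ p (j, i.2)) i.1, ?_, ?_, ?_⟩
    · have hne : ∀ (b : Bool) i, (if b then x else y) ≠ p i := by
        rintro (_ | _) i h
        · exact hyp ⟨i, h.symm⟩
        · exact hxp ⟨i, h.symm⟩
      rintro ⟨i, b⟩ ⟨j, c⟩ h
      induction i using Fin.cases <;> induction j using Fin.cases
      · cases b <;> cases c <;> simp_all [eq_comm]
      · exact (hne _ _ h).elim
      · exact (hne _ _ h.symm).elim
      · have := hp h
        simp_all
    · rintro ⟨i, b⟩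
      refine Fin.cases ?_ (fun i ↦ ?_) i
      · cases b
        · exact hy
        · exact hx
      · exact hps _
    · intro i
      refine Fin.cases ?_ (fun i ↦ ?_) i
      · exact hfxy
      · exact hpf _

/-! ### Images under linear maps, and the two projection statements -/

theorem PairwiseGeneric.isCantorSet_image {E F : Type*} [NormedAddCommGroup E] [NormedSpace ℝ E]
    [NormedAddCommGroup F] [NormedSpace ℝ F] {n : ℕ} {s : Set E} (hgen : PairwiseGeneric n s)
    (hs : IsCantorSet s) (f : E →L[ℝ] F) [FiniteDimensional ℝ (LinearMap.ker (f : E →ₗ[ℝ] F))]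
    (hn : Module.finrank ℝ (LinearMap.ker (f : E →ₗ[ℝ] F)) < n) : IsCantorSet (f '' s) := by
  refine hs.image_of_finite_identifications f.continuous ?_
  by_contra hinf
  obtain ⟨p, hp, hps, hpf⟩ := exists_injective_pairs_of_infinite hinf n
  have hli := hgen p hp hps
  let q : Fin n → LinearMap.ker (f : E →ₗ[ℝ] F) := fun i ↦
    ⟨p (i, true) - p (i, false), by simp [hpf i]⟩
  have hq : LinearIndependent ℝ q :=
    LinearIndependent.of_comp (LinearMap.ker (f : E →ₗ[ℝ] F)).subtype hli
  have := hq.fintype_card_le_finrank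
  rw [Fintype.card_fin] at this
  omega

theorem exists_linearIndependent_realEllTwo (n : ℕ) :
    ∃ b : Fin n → RealEllTwo, LinearIndependent ℝ b := by
  have h : LinearIndependent ℝ fun i : ℕ ↦ (lp.single 2 i (1 : ℝ) : RealEllTwo) := by
    rw [linearIndependent_iff']
    intro t c hc i hi
    have h0 : ((∑ j ∈ t, c j • lp.single 2 j (1 : ℝ) : RealEllTwo) : ℕ → ℝ) i = 0 := by
      rw [hc]
      rfl
    rw [lp.coeFn_sum, Finset.sum_apply, Finset.sum_eq_single_of_mem i hi fun j _ hji ↦ by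
      simp [Pi.single_eq_of_ne hji.symm]] at h0
    simpa using h0
  exact ⟨_, h.comp _ Fin.val_injective⟩

theorem corollary3 :
    (∀ N : ℕ, 2 ≤ N →
      Typical (CantorSets (EuclideanSpace ℝ (Fin N))) fun K =>
        ∀ V : Submodule ℝ (EuclideanSpace ℝ (Fin N)), V ≠ ⊥ →
          IsCantorSet (V.orthogonalProjectionOnto '' (K.1 : Set (EuclideanSpace ℝ (Fin N))))) ∧
    (Typical (CantorSets RealEllTwo) fun K =>
      ∀ (V : Submodule ℝ RealEllTwo) [V.HasOrthogonalProjection], V ≠ ⊥ →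
        FiniteDimensional ℝ (LinearMap.ker (V.orthogonalProjectionOnto : RealEllTwo →ₗ[ℝ] V)) →
          IsCantorSet (V.orthogonalProjectionOnto '' (K.1 : Set RealEllTwo))) := by
  constructor
  · intro N hN
    have : Nontrivial (EuclideanSpace ℝ (Fin N)) :=
      Module.nontrivial_of_finrank_pos (R := ℝ) (by rw [finrank_euclideanSpace_fin]; omega)
    obtain ⟨h1, h2, h3⟩ := typical_pairwiseGeneric (E := EuclideanSpace ℝ (Fin N))
    refine ⟨h1, h2, mem_of_superset h3 fun K hK V hV ↦ ?_⟩
    -- The size `n = N` suffices: as `V ≠ ⊥`, the kernel `Vᗮ` is proper.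
    refine (hK N ⟨_, (EuclideanSpace.basisFun (Fin N) ℝ).toBasis.linearIndependent⟩)
      |>.isCantorSet_image K.2 V.orthogonalProjectionOnto ?_
    have hne : LinearMap.ker
        (V.orthogonalProjectionOnto : EuclideanSpace ℝ (Fin N) →ₗ[ℝ] V) ≠ ⊤ := by
      rw [Submodule.ker_orthogonalProjectionOnto]
      simpa [Submodule.orthogonal_eq_top_iff] using hV
    simpa using Submodule.finrank_lt hne
  · have : Nontrivial RealEllTwo := by
      obtain ⟨b, hb⟩ := exists_linearIndependent_realEllTwo 1
      exact ⟨b 0, 0, hb.ne_zero 0⟩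
    obtain ⟨h1, h2, h3⟩ := typical_pairwiseGeneric (E := RealEllTwo)
    refine ⟨h1, h2, mem_of_superset h3 fun K hK V _ _ hfin ↦ ?_⟩
    -- The size is one more than the dimension of the kernel, available for every `V` because
    -- genericity holds for all `n` at once.
    exact (hK _ (exists_linearIndependent_realEllTwo _)).isCantorSet_image K.2
      V.orthogonalProjectionOnto (Nat.lt_succ_self _)
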